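/- Let $m\ge 8$ and $r\ge 1$ be integers, let $d_1,\dots,d_m$ be natural numbers, $D=\sum_{i=1}^m d_i$ and $d=D/m$. Write $\mathcal O_{n,r}=\{O\in\mathbb R^{n\times r}: O^TO=I_r\}$, let $\Theta_i\in\mathcal O_{d_i,r}$ for $i=1,\dots,m$ (so $d_i\ge r$), and let $\Theta\in\mathbb R^{D\times r}$ be the matrix with blocks $\Theta_1,\dots,\Theta_m$. Let $\|\cdot\|$ be the operator norm and $\|\cdot\|_F$ the Frobenius norm; for $X\in\mathbb R^{D\times D}$ let $X_{ij}\in\mathbb R^{d_i\times d_j}$ be its $(i,j)$ block, and for $Y\in\mathbb R^{D\times r}$ let $[Y]_i\in\mathbb R^{d_i\times r}$ be its $i$-th block. A matrix $X\in\mathbb R^{D\times D}$ is called $\Theta$-discordant if it is symmetric, $\|X\|\le 3\sqrt D$, and $\max_{1\le i\le m}\|[X\Theta]_i\|_F\le 3\sqrt{Dr\log m}$. Let $W\in\mathbb R^{D\times D}$ and $\sigma>0$ be such that $\sigma^{-1}W$ is $\Theta$-discordant and $$\sigma\le\frac{m^{1/4}}{60\sqrt{dr}}.$$ Let $S\in\mathbb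 R^{D\times D}$ be the matrix with blocks $S_{ij}=\Theta_i\Theta_j^T+W_{ij}$, $1\le i,j\le m$. Consider the problems (OTSM) maximize $\sum_{i,j=1}^m\operatorname{tr}(O_i^TS_{ij}O_j)$ over $O_i\in\mathcal O_{d_i,r}$, $i=1,\dots,m$; (SDP) maximize $\langle S,U\rangle=\operatorname{tr}(S^TU)$ over symmetric $U\in\mathbb R^{D\times D}$ with $U\succcurlyeq 0$, and $U_{ii}\preccurlyeq I$, $\operatorname{tr}(U_{ii})=r$ for all $i$; (R) maximize $\operatorname{tr}(SU)$ over the $U$ feasible for (SDP) with $\operatorname{rank}(U)=r$. Put $A=\max_{1\le i\le m}\|[W\Theta]_i\|_F+4\|W\|^2\sqrt{r/m}$. Then $m>\|W\|(4\sqrt r+1)+1$ and $$m>4m\,\frac{2A}{m-\|W\|(4\sqrt r+1)-1}+2A+8\|W\|\sqrt{\frac rm}+2\|W\|,$$ and the solutions of (OTSM) and (SDP) are equivalent: a matrix $U\in\mathbb R^{D\times D}$ solves (SDP) if and only if it solves (R), and if and only if $U=OO^T$ for some solution $(O_1,\dots,O_m)$ of (OTSM), where $O\in\mathbb R^{D\times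 r}$ is the matrix with blocks $O_1,\dots,O_m$. -/

import Mathlib

open scoped Matrix

namespace OTSM

/-- Row (and column) indices of a matrix of order `D = d 0 + ⋯ + d (m - 1)` that is partitioned
into `m` groups of sizes `d 0, …, d (m - 1)`: a group `i`, and an index inside that group. -/
abbrev Idx {m : ℕ} (d : Fin m → ℕ) : Type := (i : Fin m) × Fin (d i)

/-- The operator norm of a real square matrix, induced by the Euclidean norm. -/
noncomputable def opNorm {n : Type} [Fintype n] [DecidableEq n] (A : Matrix n n ℝ) : ℝ :=
  ‖Matrix.toEuclideanCLM (n := n) (𝕜 := ℝ) A‖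

/-- The Frobenius norm of a real matrix. -/
noncomputable def frobNorm {k l : Type} [Fintype k] [Fintype l] (A : Matrix k l ℝ) : ℝ :=
  √(∑ i, ∑ j, A i j ^ 2)

/-- The `(i, j)` block `X_{ij}`, of size `d i × d j`. -/
def block {m : ℕ} {d : Fin m → ℕ} (X : Matrix (Idx d) (Idx d) ℝ) (i j : Fin m) :
    Matrix (Fin (d i)) (Fin (d j)) ℝ :=
  Matrix.of fun a b => X ⟨i, a⟩ ⟨j, b⟩

/-- The `i`-th block `Y_i`, of size `d i × r`, of a `D × r` matrix. -/
def rowBlock {m r : ℕ} {d : Fin m → ℕ} (Y : Matrix (Idx d) (Fin r) ℝ) (i : Fin m) :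
    Matrix (Fin (d i)) (Fin r) ℝ :=
  Matrix.of fun a k => Y ⟨i, a⟩ k

/-- The `D × r` matrix whose blocks are the given `O 0, …, O (m - 1)`. -/
def stack {m r : ℕ} {d : Fin m → ℕ} (O : (i : Fin m) → Matrix (Fin (d i)) (Fin r) ℝ) :
    Matrix (Idx d) (Fin r) ℝ :=
  Matrix.of fun p k => O p.1 p.2 k

/-- The Stiefel manifold of `n × r` matrices `A` with `Aᵀ A = I`. -/
def stiefel (n r : ℕ) : Set (Matrix (Fin n) (Fin r) ℝ) := {A | Aᵀ * A = 1}

/-- `Θ`-discordance of a matrix `W`. -/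
structure IsDiscordant {m r : ℕ} {d : Fin m → ℕ}
    (Θ : (i : Fin m) → Matrix (Fin (d i)) (Fin r) ℝ) (W : Matrix (Idx d) (Idx d) ℝ) : Prop where
  symm : W.IsSymm
  opNorm_le : opNorm W ≤ 3 * √((∑ i, d i : ℕ) : ℝ)
  sup_frobNorm_le : ⨆ i, frobNorm (rowBlock (W * stack Θ) i) ≤
    3 * √(((∑ i, d i : ℕ) : ℝ) * r * Real.log m)

/-- The data matrix `S`, with blocks `S_{ij} = Θ_i Θ_jᵀ + W_{ij}` (all `i`, `j`). -/
def dataMatrix {m r : ℕ} {d : Fin m → ℕ}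
    (Θ : (i : Fin m) → Matrix (Fin (d i)) (Fin r) ℝ) (W : Matrix (Idx d) (Idx d) ℝ) :
    Matrix (Idx d) (Idx d) ℝ :=
  Matrix.of fun p q => (Θ p.1 * (Θ q.1)ᵀ + block W p.1 q.1) p.2 q.2

/-- The orthogonal trace-sum objective. -/
def traceSum {m r : ℕ} {d : Fin m → ℕ} (S : Matrix (Idx d) (Idx d) ℝ)
    (O : (i : Fin m) → Matrix (Fin (d i)) (Fin r) ℝ) : ℝ :=
  ∑ i, ∑ j, ((O i)ᵀ * block S i j * O j).trace

/-- `O` is a (global) solution of the orthogonal trace-sum maximization problem for `S`. -/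
def IsTraceSumSolution {m r : ℕ} {d : Fin m → ℕ} (S : Matrix (Idx d) (Idx d) ℝ)
    (O : (i : Fin m) → Matrix (Fin (d i)) (Fin r) ℝ) : Prop :=
  (∀ i, O i ∈ stiefel (d i) r) ∧
    ∀ O' : (i : Fin m) → Matrix (Fin (d i)) (Fin r) ℝ,
      (∀ i, O' i ∈ stiefel (d i) r) → traceSum S O' ≤ traceSum S O

/-- The feasible set of the semidefinite relaxation: `U = Uᵀ`, `U ≽ 0`, and `U_{ii} ≼ I`,
`tr U_{ii} = r` for every `i`. -/
def sdpFeasible {m : ℕ} (d : Fin m → ℕ) (r : ℕ) : Set (Matrix (Idx d) (Idx d) ℝ) :=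
  {U | U.IsSymm ∧ U.PosSemidef ∧
    ∀ i, (1 - block U i i).PosSemidef ∧ (block U i i).trace = r}

/-- `U` is a solution of the semidefinite relaxation: it maximizes `⟨S, U⟩ = tr (Sᵀ U)` over
the feasible set. -/
def IsSDPSolution {m : ℕ} {d : Fin m → ℕ} (r : ℕ) (S U : Matrix (Idx d) (Idx d) ℝ) : Prop :=
  U ∈ sdpFeasible d r ∧ ∀ U' ∈ sdpFeasible d r, (Sᵀ * U').trace ≤ (Sᵀ * U).trace

/-- `U` is a solution of the lifted form of the trace-sum problem: it maximizes `tr (S U)` over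
the matrices of rank exactly `r` that are feasible for the semidefinite relaxation. -/
def IsRankSolution {m : ℕ} {d : Fin m → ℕ} (r : ℕ) (S U : Matrix (Idx d) (Idx d) ℝ) : Prop :=
  (U ∈ sdpFeasible d r ∧ U.rank = r) ∧
    ∀ U' ∈ sdpFeasible d r, U'.rank = r → (S * U').trace ≤ (S * U).trace

/-- `max_i ‖[W Θ]_i‖_F + 4 ‖W‖² √(r / m)`. -/
noncomputable def noiseTerm {m r : ℕ} {d : Fin m → ℕ}
    (Θ : (i : Fin m) → Matrix (Fin (d i)) (Fin r) ℝ) (W : Matrix (Idx d) (Idx d) ℝ) : ℝ :=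
  (⨆ i, frobNorm (rowBlock (W * stack Θ) i)) + 4 * opNorm W ^ 2 * √((r : ℝ) / m)

/-- The deterministic smallness condition on the noise `W`. The first conjunct says that the
denominator in the second one is positive. -/
def NoiseCondition {m r : ℕ} {d : Fin m → ℕ}
    (Θ : (i : Fin m) → Matrix (Fin (d i)) (Fin r) ℝ) (W : Matrix (Idx d) (Idx d) ℝ) : Prop :=
  opNorm W * (4 * √(r : ℝ) + 1) + 1 < (m : ℝ) ∧
  4 * (m : ℝ) * (2 * noiseTerm Θ W / ((m : ℝ) - opNorm W * (4 * √(r : ℝ) + 1) - 1))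
    + 2 * noiseTerm Θ W + 8 * opNorm W * √((r : ℝ) / m) + 2 * opNorm W < (m : ℝ)

end OTSM

/-! Let `V` stack a global maximizer of the trace sum. The objective is unchanged under a common
right rotation, so `Θᵀ V` may be taken positive semidefinite (`exists_isTraceSumSolution`). Write `E
= V - Θ` for stacked `Θ`; then `Θᵀ V = m I - EᵀE / 2`.

Optimality of `V` against `Θ` forces `E` to be small in Frobenius norm
(`IsTraceSumSolution.mul_frobNorm_sub_le`), and optimality against replacing one block by `Θ i`
makes every `O i - Θ i` small (`IsTraceSumSolution.mul_frobNorm_block_sub_le`). The first order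
condition gives `(S V)_i = O i * Λ i` with `Λ i` symmetric (`IsTraceSumSolution.stationary`), and
closeness to `Θ` puts `Λ i` near `m I`, hence above `t I` with `t = 0.8 m`. On the orthogonal
complement of the columns of `V` the signal in `S` almost vanishes, so `S` is at most `0.1 m` there.

These two facts yield a dual certificate (`isSDPSolution_iff_of_certificate`): a block diagonal `K`
with `(K - S) V = 0` and `K - S` strictly positive on that complement. Hence `V Vᵀ` is the only
solution of the relaxation; it has rank `r` and comes from the trace-sum problem, and all
equivalences follow formally (`equivalences_of_unique`).

Discordance enters only through two numerical bounds (`noise_bounds`). They feed the certificate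
directly; the noise condition is a parallel consequence of them. -/

namespace OTSM

/-! ### Frobenius and operator norms -/

section Frobenius

variable {k l n : Type} [Fintype k] [Fintype l] [Fintype n]

lemma frobNorm_nonneg (A : Matrix k l ℝ) : 0 ≤ frobNorm A := Real.sqrt_nonneg _

lemma sq_frobNorm (A : Matrix k l ℝ) : frobNorm A ^ 2 = ∑ i, ∑ j, A i j ^ 2 :=
  Real.sq_sqrt (by positivity)

lemma trace_transpose_mul (A B : Matrix k l ℝ) :
    (Aᵀ * B).trace = ∑ i, ∑ j, A i j * B i j := by
  simp only [Matrix.trace, Matrix.diag_apply, Matrix.mul_apply, Matrix.transpose_apply]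
  exact Finset.sum_comm

lemma trace_transpose_mul_self (A : Matrix k l ℝ) : (Aᵀ * A).trace = frobNorm A ^ 2 := by
  rw [sq_frobNorm, trace_transpose_mul]
  simp only [sq]

lemma trace_transpose_mul_comm (A B : Matrix k l ℝ) : (Aᵀ * B).trace = (Bᵀ * A).trace := by
  simp only [trace_transpose_mul, mul_comm]

lemma abs_trace_transpose_mul_le (A B : Matrix k l ℝ) :
    |(Aᵀ * B).trace| ≤ frobNorm A * frobNorm B := by
  apply abs_le_of_sq_le_sq _ (mul_nonneg (frobNorm_nonneg A) (frobNorm_nonneg B))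
  rw [mul_pow, sq_frobNorm, sq_frobNorm, trace_transpose_mul]
  simp only [← Fintype.sum_prod_type']
  exact Finset.sum_mul_sq_le_sq_mul_sq _ _ _

lemma trace_transpose_mul_le (A B : Matrix k l ℝ) :
    (Aᵀ * B).trace ≤ frobNorm A * frobNorm B :=
  (le_abs_self _).trans (abs_trace_transpose_mul_le A B)

open scoped Matrix.Norms.Frobenius in
lemma frobNorm_eq_norm (A : Matrix k l ℝ) : frobNorm A = ‖A‖ := by
  rw [Matrix.frobenius_norm_def, frobNorm, Real.sqrt_eq_rpow]
  simp

open scoped Matrix.Norms.Frobenius in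
lemma frobNorm_add_le (A B : Matrix k l ℝ) : frobNorm (A + B) ≤ frobNorm A + frobNorm B := by
  simpa only [frobNorm_eq_norm] using norm_add_le A B

open scoped Matrix.Norms.Frobenius in
lemma frobNorm_sub_le (A B : Matrix k l ℝ) : frobNorm (A - B) ≤ frobNorm A + frobNorm B := by
  simpa only [frobNorm_eq_norm] using norm_sub_le A B

open scoped Matrix.Norms.Frobenius in
lemma frobNorm_mul_le (A : Matrix k l ℝ) (B : Matrix l n ℝ) :
    frobNorm (A * B) ≤ frobNorm A * frobNorm B := by
  simpa only [frobNorm_eq_norm] using Matrix.frobenius_norm_mul A B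

open scoped Matrix.Norms.Frobenius in
lemma frobNorm_smul (c : ℝ) (A : Matrix k l ℝ) : frobNorm (c • A) = |c| * frobNorm A := by
  rw [frobNorm_eq_norm, frobNorm_eq_norm, norm_smul, Real.norm_eq_abs]

lemma frobNorm_transpose (A : Matrix k l ℝ) : frobNorm Aᵀ = frobNorm A := by
  rw [frobNorm, frobNorm, Finset.sum_comm]
  rfl

open scoped Matrix.Norms.Frobenius in
lemma frobNorm_eq_zero {A : Matrix k l ℝ} (h : frobNorm A = 0) : A = 0 := by
  rwa [frobNorm_eq_norm, norm_eq_zero] at h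

lemma sum_sq_mulVec_le [DecidableEq k] (W : Matrix k k ℝ) (x : k → ℝ) :
    ∑ i, (W *ᵥ x) i ^ 2 ≤ opNorm W ^ 2 * ∑ i, x i ^ 2 := by
  have h := (Matrix.toEuclideanCLM (n := k) (𝕜 := ℝ) W).le_opNorm (WithLp.toLp 2 x)
  have h2 := pow_le_pow_left₀ (norm_nonneg _) h 2
  rw [mul_pow, EuclideanSpace.norm_sq_eq, EuclideanSpace.norm_sq_eq] at h2
  simpa [opNorm] using h2

lemma opNorm_nonneg [DecidableEq k] (W : Matrix k k ℝ) : 0 ≤ opNorm W := norm_nonneg _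

lemma opNorm_smul [DecidableEq k] (c : ℝ) (W : Matrix k k ℝ) :
    opNorm (c • W) = |c| * opNorm W := by
  rw [opNorm, map_smul, norm_smul, Real.norm_eq_abs, opNorm]

lemma frobNorm_mul_le_opNorm [DecidableEq k] (W : Matrix k k ℝ) (X : Matrix k l ℝ) :
    frobNorm (W * X) ≤ opNorm W * frobNorm X := by
  refine (abs_le_of_sq_le_sq' ?_ (mul_nonneg (opNorm_nonneg W) (frobNorm_nonneg X))).2
  rw [mul_pow, ← frobNorm_transpose, ← frobNorm_transpose X, sq_frobNorm, sq_frobNorm,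
    Finset.mul_sum]
  exact Finset.sum_le_sum fun j _ => sum_sq_mulVec_le W fun i => X i j

lemma abs_trace_conj_le_opNorm [DecidableEq k] (W : Matrix k k ℝ) (X Y : Matrix k l ℝ) :
    |(Xᵀ * W * Y).trace| ≤ opNorm W * frobNorm X * frobNorm Y := by
  rw [Matrix.mul_assoc]
  calc _ ≤ frobNorm X * frobNorm (W * Y) := abs_trace_transpose_mul_le X (W * Y)
    _ ≤ frobNorm X * (opNorm W * frobNorm Y) :=
      mul_le_mul_of_nonneg_left (frobNorm_mul_le_opNorm W Y) (frobNorm_nonneg X)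
    _ = _ := by ring

end Frobenius

/-! ### Positive semidefinite matrices -/

section PosSemidef

variable {k l : Type} [Fintype k] [Fintype l]

open scoped MatrixOrder Matrix.Norms.L2Operator in
lemma exists_eq_mul_transpose {U : Matrix k k ℝ} (hU : U.PosSemidef) :
    ∃ X : Matrix k k ℝ, U = X * Xᵀ := by
  classical
  obtain ⟨B, hB⟩ := (CStarAlgebra.nonneg_iff_eq_star_mul_self (a := U)).1 hU.nonneg
  exact ⟨Bᵀ, by simpa [Matrix.star_eq_conjTranspose] using hB⟩

lemma posSemidef_mul_transpose_self (X : Matrix k l ℝ) : (X * Xᵀ).PosSemidef := by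
  simpa using Matrix.posSemidef_self_mul_conjTranspose X

lemma posSemidef_transpose_mul_mul {M : Matrix k k ℝ} (hM : M.PosSemidef) (X : Matrix k l ℝ) :
    (Xᵀ * M * X).PosSemidef := by
  simpa using hM.conjTranspose_mul_mul_same X

lemma trace_mul_nonneg {M N : Matrix k k ℝ} (hM : M.PosSemidef) (hN : N.PosSemidef) :
    0 ≤ (M * N).trace := by
  obtain ⟨X, rfl⟩ := exists_eq_mul_transpose hN
  rw [← Matrix.mul_assoc, Matrix.trace_mul_comm, ← Matrix.mul_assoc]
  exact (posSemidef_transpose_mul_mul hM X).trace_nonneg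

lemma dotProduct_mulVec_eq_trace (M : Matrix k k ℝ) (x : k → ℝ) :
    x ⬝ᵥ M *ᵥ x =
      ((Matrix.replicateCol Unit x)ᵀ * (M * Matrix.replicateCol Unit x)).trace := by
  rw [trace_transpose_mul]
  simp [dotProduct, Matrix.mul_apply, Matrix.mulVec]

lemma posSemidef_of_trace_nonneg {M : Matrix k k ℝ} (hM : M.IsSymm)
    (h : ∀ X : Matrix k Unit ℝ, 0 ≤ (Xᵀ * (M * X)).trace) : M.PosSemidef := by
  refine Matrix.PosSemidef.of_dotProduct_mulVec_nonneg (by simpa [Matrix.IsHermitian] using hM.eq)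
    fun x => ?_
  rw [star_trivial, dotProduct_mulVec_eq_trace]
  exact h _

/-- A symmetric matrix within Frobenius distance `c - t` of `c I` is bounded below by `t I`. -/
lemma posSemidef_sub_smul_one [DecidableEq k] {M : Matrix k k ℝ} (hM : M.IsSymm) {c t : ℝ}
    (h : frobNorm (M - c • 1) ≤ c - t) : (M - t • 1).PosSemidef := by
  refine posSemidef_of_trace_nonneg ?_ fun X => ?_
  · rw [Matrix.IsSymm, Matrix.transpose_sub, hM.eq]; simp
  · have h1 : (Xᵀ * ((M - t • 1) * X)).trace
        = (Xᵀ * ((M - c • 1) * X)).trace + (c - t) * frobNorm X ^ 2 := by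
      rw [← trace_transpose_mul_self, ← smul_eq_mul, ← Matrix.trace_smul, ← Matrix.trace_add]
      congr 1
      simp only [Matrix.sub_mul, Matrix.mul_sub, Matrix.smul_mul, Matrix.mul_smul, Matrix.one_mul,
        sub_smul]
      abel
    have h2 := abs_trace_transpose_mul_le X ((M - c • 1) * X)
    have h3 := frobNorm_mul_le (M - c • 1) X
    have h4 := frobNorm_nonneg X
    have h5 : frobNorm X * frobNorm ((M - c • 1) * X) ≤ (c - t) * frobNorm X ^ 2 := by
      calc _ ≤ frobNorm X * ((c - t) * frobNorm X) := by
            refine mul_le_mul_of_nonneg_left (h3.trans ?_) h4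
            exact mul_le_mul_of_nonneg_right h h4
        _ = _ := by ring
    rw [h1]
    linarith [neg_abs_le (Xᵀ * ((M - c • 1) * X)).trace]

end PosSemidef

/-! ### Linear forms on the Stiefel manifold and the polar decomposition -/

section Stiefel

variable {n r : ℕ}

lemma frobNorm_sq_of_mem_stiefel {O : Matrix (Fin n) (Fin r) ℝ} (hO : O ∈ stiefel n r) :
    frobNorm O ^ 2 = r := by
  have h : Oᵀ * O = 1 := hO
  rw [← trace_transpose_mul_self, h]
  simp

lemma mul_mem_stiefel {O : Matrix (Fin n) (Fin r) ℝ} (hO : O ∈ stiefel n r)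
    {G : Matrix (Fin n) (Fin n) ℝ} (hG : Gᵀ * G = 1) : G * O ∈ stiefel n r := by
  have h : Oᵀ * O = 1 := hO
  change (G * O)ᵀ * (G * O) = 1
  rw [Matrix.transpose_mul, Matrix.mul_assoc, ← Matrix.mul_assoc _ G, hG, Matrix.one_mul, h]

lemma mem_stiefel_mul {O : Matrix (Fin n) (Fin r) ℝ} (hO : O ∈ stiefel n r)
    {Q : Matrix (Fin r) (Fin r) ℝ} (hQ : Qᵀ * Q = 1) : O * Q ∈ stiefel n r := by
  have h : Oᵀ * O = 1 := hO
  change (O * Q)ᵀ * (O * Q) = 1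
  rw [Matrix.transpose_mul, Matrix.mul_assoc, ← Matrix.mul_assoc _ O, h, Matrix.one_mul, hQ]

/-- Rodrigues' formula: since `J` is skew with `J³ = -J`, this is the rotation with cosine `c` and
sine `s` generated by `J`. -/
lemma rotation_transpose_mul_self {J : Matrix (Fin n) (Fin n) ℝ} (hJ : Jᵀ = -J)
    (hJ3 : J * J * J = -J) {c s : ℝ} (hcs : c ^ 2 + s ^ 2 = 1) :
    (1 + s • J + (1 - c) • (J * J))ᵀ * (1 + s • J + (1 - c) • (J * J)) = 1 := by
  have hJ4 : J * J * (J * J) = -(J * J) := by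
    rw [← Matrix.mul_assoc, hJ3, Matrix.neg_mul]
  have hJ3' : J * (J * J) = -J := by rw [← Matrix.mul_assoc, hJ3]
  simp only [Matrix.transpose_add, Matrix.transpose_one, Matrix.transpose_smul,
    Matrix.transpose_mul, hJ, Matrix.add_mul, Matrix.mul_add, Matrix.one_mul,
    Matrix.mul_one, Matrix.smul_mul, Matrix.mul_smul, Matrix.neg_mul, Matrix.mul_neg, hJ3, hJ3',
    hJ4, smul_neg]
  have : s * s = 1 - c * c := by linarith
  match_scalars <;> linarith

/-- The first order condition for maximizing a linear form over the Stiefel manifold. -/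
lemma mul_transpose_symm_of_isMax {O B : Matrix (Fin n) (Fin r) ℝ} (hO : O ∈ stiefel n r)
    (hmax : ∀ O' ∈ stiefel n r, (O'ᵀ * B).trace ≤ (Oᵀ * B).trace) : (B * Oᵀ).IsSymm := by
  have key : ∀ J : Matrix (Fin n) (Fin n) ℝ, Jᵀ = -J → J * J * J = -J →
      ((J * O)ᵀ * B).trace = 0 := by
    intro J hJ hJ3
    set y := ((J * O)ᵀ * B).trace with hy
    set z := ((J * J * O)ᵀ * B).trace with hz
    have h : ∀ t : ℝ, t * y + t ^ 2 * z ≤ 0 := by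
      intro t
      -- The rational parametrization of the circle turns the gain along the rotation into a
      -- positive multiple of `t y + t² z`, so no derivative is needed.
      have hpos : 0 < 1 + t ^ 2 := by positivity
      have h1 := hmax _ (mul_mem_stiefel hO (rotation_transpose_mul_self hJ hJ3
        (c := (1 - t ^ 2) / (1 + t ^ 2)) (s := 2 * t / (1 + t ^ 2)) (by field_simp; ring)))
      simp only [Matrix.add_mul, Matrix.one_mul, Matrix.smul_mul, Matrix.transpose_add,
        Matrix.transpose_smul, Matrix.trace_add, Matrix.trace_smul, smul_eq_mul, ← hy, ← hz] at h1
      have h2 : 2 * t / (1 + t ^ 2) * y + (1 - (1 - t ^ 2) / (1 + t ^ 2)) * z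
          = 2 / (1 + t ^ 2) * (t * y + t ^ 2 * z) := by field_simp; ring
      by_contra! hcon
      have h3 : 0 < 2 / (1 + t ^ 2) * (t * y + t ^ 2 * z) := by positivity
      linarith
    by_contra hy0
    have hz1 : 0 < 1 + |z| := by positivity
    -- A step this short lets the linear term dominate, so `y ≠ 0` would give a strict gain.
    have h4 := h (y / (1 + |z|))
    have h5 : y / (1 + |z|) * y + (y / (1 + |z|)) ^ 2 * z
        = y ^ 2 * (1 + |z| + z) / (1 + |z|) ^ 2 := by field_simp
    rw [h5] at h4
    have h6 : 0 < 1 + |z| + z := by linarith [neg_abs_le z]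
    have h7 : 0 < y ^ 2 * (1 + |z| + z) / (1 + |z|) ^ 2 := by positivity
    linarith
  have hentry : ∀ a b : Fin n,
      ((Matrix.single a b (1 : ℝ) * O)ᵀ * B).trace = (B * Oᵀ) a b := by
    intro a b
    rw [Matrix.transpose_mul, Matrix.mul_assoc, Matrix.trace_mul_comm, Matrix.mul_assoc,
      Matrix.transpose_single, Matrix.trace_single_mul]
    simp
  ext a b
  rw [Matrix.transpose_apply]
  rcases eq_or_ne a b with rfl | hab
  · rfl
  -- The generator of rotations in the `(a, b)` coordinate plane reads off the antisymmetric part of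
  -- `B * Oᵀ` at that entry.
  have h := key (Matrix.single a b 1 - Matrix.single b a 1) (by simp)
    (by simp [Matrix.mul_sub, Matrix.sub_mul, hab, hab.symm, neg_add_eq_sub])
  rw [Matrix.sub_mul, Matrix.transpose_sub, Matrix.sub_mul, Matrix.trace_sub, hentry, hentry] at h
  linarith

lemma eq_mul_of_isMax {O B : Matrix (Fin n) (Fin r) ℝ} (hO : O ∈ stiefel n r)
    (hmax : ∀ O' ∈ stiefel n r, (O'ᵀ * B).trace ≤ (Oᵀ * B).trace) :
    (Oᵀ * B).IsSymm ∧ B = O * (Oᵀ * B) := by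
  have h : Oᵀ * O = 1 := hO
  have hs : O * Bᵀ = B * Oᵀ := by
    have := (mul_transpose_symm_of_isMax hO hmax).eq
    rwa [Matrix.transpose_mul, Matrix.transpose_transpose] at this
  have h1 : B = O * (Bᵀ * O) := by
    rw [← Matrix.mul_assoc, hs, Matrix.mul_assoc, h, Matrix.mul_one]
  have h2 : Oᵀ * B = Bᵀ * O := by
    conv_lhs => rw [h1]
    rw [← Matrix.mul_assoc, h, Matrix.one_mul]
  refine ⟨?_, by rw [h2]; exact h1⟩
  rw [Matrix.IsSymm, Matrix.transpose_mul, Matrix.transpose_transpose, h2]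

/-- Maximizing `tr (Qᵀ B)` over orthogonal `Q` gives the polar decomposition of `B`. -/
lemma posSemidef_of_isMax {Q B : Matrix (Fin r) (Fin r) ℝ} (hQ : Q ∈ stiefel r r)
    (hmax : ∀ Q' ∈ stiefel r r, (Q'ᵀ * B).trace ≤ (Qᵀ * B).trace) : (Qᵀ * B).PosSemidef := by
  refine Matrix.PosSemidef.of_dotProduct_mulVec_nonneg
    (by simpa [Matrix.IsHermitian] using (eq_mul_of_isMax hQ hmax).1.eq) fun x => ?_
  rw [star_trivial]
  rcases eq_or_ne x 0 with rfl | hx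
  · simp
  have hxx : 0 < x ⬝ᵥ x := by
    refine lt_of_le_of_ne (by simpa using dotProduct_star_self_nonneg x) fun h => hx ?_
    simpa using dotProduct_star_self_eq_zero.1 ((by simpa using h.symm : x ⬝ᵥ star x = 0))
  set V := Matrix.vecMulVec x x with hV
  have hVt : Vᵀ = V := by rw [hV, Matrix.transpose_vecMulVec]
  have hVV : V * V = (x ⬝ᵥ x) • V := by
    rw [hV, Matrix.vecMulVec_mul_vecMulVec]
    ext; simp [Matrix.vecMulVec_apply]; ring
  -- Householder reflection along `x`: replacing `Q` by `Q * G` changes the objective by a negative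
  -- multiple of the quadratic form of `Qᵀ * B` at `x`.
  set G : Matrix (Fin r) (Fin r) ℝ := 1 - (2 / (x ⬝ᵥ x)) • V with hG
  have hGt : Gᵀ = G := by rw [hG]; simp [hVt]
  have hGG : Gᵀ * G = 1 := by
    rw [hGt, hG]
    simp only [Matrix.sub_mul, Matrix.mul_sub, Matrix.one_mul, Matrix.mul_one, Matrix.smul_mul,
      Matrix.mul_smul, hVV, smul_smul]
    have : 2 / (x ⬝ᵥ x) * (2 / (x ⬝ᵥ x) * (x ⬝ᵥ x)) = 2 * (2 / (x ⬝ᵥ x)) := by field_simp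
    match_scalars <;> linarith
  have h := hmax _ (mem_stiefel_mul hQ hGG)
  rw [Matrix.transpose_mul, hGt, Matrix.mul_assoc, hG, Matrix.sub_mul, Matrix.one_mul,
    Matrix.trace_sub, Matrix.smul_mul, Matrix.trace_smul, smul_eq_mul] at h
  have h1 : (V * (Qᵀ * B)).trace = x ⬝ᵥ (Qᵀ * B) *ᵥ x := by
    rw [hV, Matrix.vecMulVec_mul, Matrix.trace_vecMulVec, dotProduct_comm,
      Matrix.dotProduct_mulVec, dotProduct_comm]
  rw [h1] at h
  have h2 : 0 ≤ 2 / (x ⬝ᵥ x) * (x ⬝ᵥ (Qᵀ * B) *ᵥ x) := by linarith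
  exact nonneg_of_mul_nonneg_right h2 (by positivity)

lemma isCompact_stiefel : IsCompact (stiefel n r) := by
  refine (isCompact_univ_pi fun _ : Fin n => isCompact_univ_pi fun _ : Fin r =>
    isCompact_Icc (a := (-√r : ℝ)) (b := √r)).of_isClosed_subset ?_ ?_
  · exact isClosed_eq (by fun_prop) continuous_const
  · intro (O : Matrix (Fin n) (Fin r) ℝ) hO i _ j _
    have h : O i j ^ 2 ≤ r := by
      rw [← frobNorm_sq_of_mem_stiefel hO, sq_frobNorm]
      exact (Finset.single_le_sum (f := fun j => O i j ^ 2) (fun _ _ => sq_nonneg _)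
        (Finset.mem_univ j)).trans
        (Finset.single_le_sum (f := fun i => ∑ j, O i j ^ 2)
          (fun _ _ => Finset.sum_nonneg fun _ _ => sq_nonneg _) (Finset.mem_univ i))
    exact abs_le.1 (Real.abs_le_sqrt h)

lemma exists_polar (B : Matrix (Fin r) (Fin r) ℝ) :
    ∃ Q : Matrix (Fin r) (Fin r) ℝ, Qᵀ * Q = 1 ∧ (Qᵀ * B).PosSemidef := by
  obtain ⟨Q, hQ, hmax⟩ := (isCompact_stiefel (n := r) (r := r)).exists_isMaxOn
    ⟨1, by simp [stiefel]⟩ (f := fun Q => (Qᵀ * B).trace) (by fun_prop)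
  exact ⟨Q, hQ, posSemidef_of_isMax hQ fun Q' hQ' => hmax hQ'⟩

lemma frobNorm_mul_of_mem_stiefel {l : Type} [Fintype l] {O : Matrix (Fin n) (Fin r) ℝ}
    (hO : O ∈ stiefel n r) (Y : Matrix (Fin r) l ℝ) : frobNorm (O * Y) = frobNorm Y := by
  have h : Oᵀ * O = 1 := hO
  rw [← sq_eq_sq₀ (frobNorm_nonneg _) (frobNorm_nonneg _), ← trace_transpose_mul_self,
    ← trace_transpose_mul_self, Matrix.transpose_mul, Matrix.mul_assoc, ← Matrix.mul_assoc _ O, h,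
    Matrix.one_mul]

/-- The square of the left side is the inner product of `O * (Oᵀ * Y)` with `Y`, and `O` preserves
the norm; apply Cauchy–Schwarz and cancel. -/
lemma frobNorm_transpose_mul_le_of_mem_stiefel {l : Type} [Fintype l]
    {O : Matrix (Fin n) (Fin r) ℝ} (hO : O ∈ stiefel n r) (Y : Matrix (Fin n) l ℝ) :
    frobNorm (Oᵀ * Y) ≤ frobNorm Y := by
  have h := trace_transpose_mul_le (O * (Oᵀ * Y)) Y
  rw [frobNorm_mul_of_mem_stiefel hO, Matrix.transpose_mul, Matrix.mul_assoc,
    trace_transpose_mul_self, sq] at h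
  by_contra! hlt
  have := (frobNorm_nonneg Y).trans_lt hlt
  exact absurd h (not_le.2 (mul_lt_mul_of_pos_left hlt this))

end Stiefel

/-! ### Block calculus for stacked and block diagonal matrices -/

section Blocks

variable {m r : ℕ} {d : Fin m → ℕ}

lemma dataMatrix_eq (Θ : (i : Fin m) → Matrix (Fin (d i)) (Fin r) ℝ)
    (W : Matrix (Idx d) (Idx d) ℝ) : dataMatrix Θ W = stack Θ * (stack Θ)ᵀ + W := by
  ext p q
  simp [dataMatrix, stack, block, Matrix.mul_apply]

lemma trace_stack_transpose_mul (O : (i : Fin m) → Matrix (Fin (d i)) (Fin r) ℝ)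
    (Y : Matrix (Idx d) (Fin r) ℝ) :
    ((stack O)ᵀ * Y).trace = ∑ i, ((O i)ᵀ * rowBlock Y i).trace := by
  simp only [trace_transpose_mul, stack, rowBlock, Matrix.of_apply, Fintype.sum_sigma]

lemma sq_frobNorm_eq_sum (Y : Matrix (Idx d) (Fin r) ℝ) :
    frobNorm Y ^ 2 = ∑ i, frobNorm (rowBlock Y i) ^ 2 := by
  simp only [sq_frobNorm, rowBlock, Matrix.of_apply, Fintype.sum_sigma]

lemma frobNorm_rowBlock_le (Y : Matrix (Idx d) (Fin r) ℝ) (i : Fin m) :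
    frobNorm (rowBlock Y i) ≤ frobNorm Y := by
  refine (abs_le_of_sq_le_sq' ?_ (frobNorm_nonneg Y)).2
  rw [sq_frobNorm_eq_sum]
  exact Finset.single_le_sum (f := fun i => frobNorm (rowBlock Y i) ^ 2)
    (fun _ _ => sq_nonneg _) (Finset.mem_univ i)

lemma rowBlock_stack (O : (i : Fin m) → Matrix (Fin (d i)) (Fin r) ℝ) (i : Fin m) :
    rowBlock (stack O) i = O i := rfl

lemma rowBlock_stack_mul (O : (i : Fin m) → Matrix (Fin (d i)) (Fin r) ℝ)
    (X : Matrix (Fin r) (Fin r) ℝ) (i : Fin m) : rowBlock (stack O * X) i = O i * X := rfl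

lemma rowBlock_add (X Y : Matrix (Idx d) (Fin r) ℝ) (i : Fin m) :
    rowBlock (X + Y) i = rowBlock X i + rowBlock Y i := rfl

lemma rowBlock_smul (c : ℝ) (Y : Matrix (Idx d) (Fin r) ℝ) (i : Fin m) :
    rowBlock (c • Y) i = c • rowBlock Y i := rfl

lemma rowBlock_injective {X Y : Matrix (Idx d) (Fin r) ℝ}
    (h : ∀ i, rowBlock X i = rowBlock Y i) : X = Y := by
  ext ⟨i, a⟩ k
  exact congrFun (congrFun (h i) a) k

lemma stack_transpose_mul_stack (O : (i : Fin m) → Matrix (Fin (d i)) (Fin r) ℝ)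
    (O' : (i : Fin m) → Matrix (Fin (d i)) (Fin r) ℝ) :
    (stack O)ᵀ * stack O' = ∑ i, (O i)ᵀ * O' i := by
  ext a b
  simp [Matrix.mul_apply, stack, Fintype.sum_sigma, Matrix.sum_apply]

lemma stack_transpose_mul_self {O : (i : Fin m) → Matrix (Fin (d i)) (Fin r) ℝ}
    (hO : ∀ i, O i ∈ stiefel (d i) r) : (stack O)ᵀ * stack O = (m : ℝ) • 1 := by
  have h : ∀ i, (O i)ᵀ * O i = 1 := hO
  rw [stack_transpose_mul_stack, Finset.sum_congr rfl fun i _ => h i]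
  simp [Nat.cast_smul_eq_nsmul]

lemma traceSum_eq (S : Matrix (Idx d) (Idx d) ℝ)
    (O : (i : Fin m) → Matrix (Fin (d i)) (Fin r) ℝ) :
    traceSum S O = ((stack O)ᵀ * (S * stack O)).trace := by
  rw [trace_stack_transpose_mul, traceSum]
  refine Finset.sum_congr rfl fun i _ => ?_
  rw [← Matrix.trace_sum]
  simp only [Matrix.mul_assoc]
  rw [← Matrix.mul_sum]
  congr 2
  ext a k
  simp [rowBlock, block, stack, Matrix.mul_apply, Matrix.sum_apply, Fintype.sum_sigma]

lemma traceSum_eq_trace_mul (S : Matrix (Idx d) (Idx d) ℝ)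
    (O : (i : Fin m) → Matrix (Fin (d i)) (Fin r) ℝ) :
    traceSum S O = (S * (stack O * (stack O)ᵀ)).trace := by
  rw [traceSum_eq, Matrix.trace_mul_comm, Matrix.mul_assoc]

lemma block_stack_conj (O : (i : Fin m) → Matrix (Fin (d i)) (Fin r) ℝ)
    (C : Matrix (Fin r) (Fin r) ℝ) (i j : Fin m) :
    block (stack O * C * (stack O)ᵀ) i j = O i * C * (O j)ᵀ := rfl

lemma block_stack_mul_transpose (O : (i : Fin m) → Matrix (Fin (d i)) (Fin r) ℝ)
    (i j : Fin m) : block (stack O * (stack O)ᵀ) i j = O i * (O j)ᵀ := rfl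

lemma trace_mul_transpose_of_mem_stiefel {n : ℕ} {O : Matrix (Fin n) (Fin r) ℝ}
    (hO : O ∈ stiefel n r) : (O * Oᵀ).trace = r := by
  rw [Matrix.trace_mul_comm, trace_transpose_mul_self, frobNorm_sq_of_mem_stiefel hO]

lemma posSemidef_one_sub_of_mem_stiefel {n : ℕ} {O : Matrix (Fin n) (Fin r) ℝ}
    (hO : O ∈ stiefel n r) : (1 - O * Oᵀ).PosSemidef := by
  have h : Oᵀ * O = 1 := hO
  have h1 : (1 - O * Oᵀ) * (1 - O * Oᵀ)ᵀ = 1 - O * Oᵀ := by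
    have : O * Oᵀ * (O * Oᵀ) = O * Oᵀ := by
      rw [Matrix.mul_assoc, ← Matrix.mul_assoc _ O, h, Matrix.one_mul]
    simp [Matrix.sub_mul, Matrix.mul_sub, this]
  rw [← h1]
  exact posSemidef_mul_transpose_self _

lemma stack_mul_transpose_mem_sdpFeasible {O : (i : Fin m) → Matrix (Fin (d i)) (Fin r) ℝ}
    (hO : ∀ i, O i ∈ stiefel (d i) r) : stack O * (stack O)ᵀ ∈ sdpFeasible d r := by
  refine ⟨by simp [Matrix.IsSymm], posSemidef_mul_transpose_self _, fun i => ?_⟩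
  rw [block_stack_mul_transpose]
  exact ⟨posSemidef_one_sub_of_mem_stiefel (hO i), trace_mul_transpose_of_mem_stiefel (hO i)⟩

lemma rank_stack_mul_transpose (hm : 0 < m) {O : (i : Fin m) → Matrix (Fin (d i)) (Fin r) ℝ}
    (hO : ∀ i, O i ∈ stiefel (d i) r) : (stack O * (stack O)ᵀ).rank = r := by
  rw [Matrix.rank_self_mul_transpose, ← Matrix.rank_transpose_mul_self,
    stack_transpose_mul_self hO, Matrix.rank_of_isUnit _ ?_, Fintype.card_fin]
  rw [Matrix.isUnit_iff_isUnit_det]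
  have : (m : ℝ) ≠ 0 := by positivity
  simp [this]

lemma trace_blockDiagonal'_mul (K : (i : Fin m) → Matrix (Fin (d i)) (Fin (d i)) ℝ)
    (U : Matrix (Idx d) (Idx d) ℝ) :
    (Matrix.blockDiagonal' K * U).trace = ∑ i, (K i * block U i i).trace := by
  simp only [Matrix.trace, Matrix.diag_apply, Matrix.mul_apply, Fintype.sum_sigma, block,
    Matrix.of_apply]
  refine Finset.sum_congr rfl fun i _ => Finset.sum_congr rfl fun a _ => ?_
  rw [Finset.sum_eq_single i (fun j _ hj => Finset.sum_eq_zero fun b _ => by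
    rw [Matrix.blockDiagonal'_apply_ne _ _ _ hj.symm, zero_mul]) (by simp)]
  simp only [Matrix.blockDiagonal'_apply_eq]

lemma rowBlock_blockDiagonal'_mul (K : (i : Fin m) → Matrix (Fin (d i)) (Fin (d i)) ℝ)
    (Y : Matrix (Idx d) (Fin r) ℝ) (i : Fin m) :
    rowBlock (Matrix.blockDiagonal' K * Y) i = K i * rowBlock Y i := by
  ext a k
  simp only [rowBlock, Matrix.of_apply, Matrix.mul_apply, Fintype.sum_sigma]
  rw [Finset.sum_eq_single i (fun j _ hj => Finset.sum_eq_zero fun b _ => by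
    rw [Matrix.blockDiagonal'_apply_ne _ _ _ hj.symm, zero_mul]) (by simp)]
  simp only [Matrix.blockDiagonal'_apply_eq]

lemma trace_eq_sum_block (U : Matrix (Idx d) (Idx d) ℝ) :
    U.trace = ∑ i, (block U i i).trace := by
  simp [Matrix.trace, block, Fintype.sum_sigma]

lemma posSemidef_block {U : Matrix (Idx d) (Idx d) ℝ} (hU : U.PosSemidef) (i : Fin m) :
    (block U i i).PosSemidef := hU.submatrix (Sigma.mk i)

end Blocks

/-! ### The dual certificate -/

section Certificate

variable {m r : ℕ} {d : Fin m → ℕ}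

/-- Dual certificate: it makes `V Vᵀ`, where `V` stacks the blocks `O i`, the only solution of
the semidefinite relaxation. -/
theorem isSDPSolution_iff_of_certificate (hm : 0 < m) {S : Matrix (Idx d) (Idx d) ℝ}
    (hS : S.IsSymm) {O : (i : Fin m) → Matrix (Fin (d i)) (Fin r) ℝ}
    (hO : ∀ i, O i ∈ stiefel (d i) r) (Λ : Fin m → Matrix (Fin r) (Fin r) ℝ)
    (hSO : ∀ i, rowBlock (S * stack O) i = O i * Λ i) {t κ : ℝ} (hκ : 0 < κ)
    (hΛ : ∀ i, (Λ i - t • 1).PosSemidef)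
    (hSZ : ∀ Z : Matrix (Idx d) (Idx d) ℝ, (stack O)ᵀ * Z = 0 →
      (Zᵀ * (S * Z)).trace ≤ (t - κ) * frobNorm Z ^ 2)
    (U : Matrix (Idx d) (Idx d) ℝ) :
    IsSDPSolution r S U ↔ U = stack O * (stack O)ᵀ := by
  have hO1 : ∀ i, (O i)ᵀ * O i = 1 := hO
  have hm0 : (m : ℝ) ≠ 0 := by positivity
  set V := stack O with hV
  set M : Fin m → Matrix (Fin r) (Fin r) ℝ := fun i => Λ i - t • 1 with hM
  have hMs : ∀ i, (M i)ᵀ = M i := fun i => by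
    rw [← Matrix.conjTranspose_eq_transpose_of_trivial]
    exact (hΛ i).isHermitian.eq
  -- `M i` is the multiplier of `U_ii ≼ I` and `t` that of the trace constraint. `K i` acts as `Λ i`
  -- on the range of `O i` and as `t` on its complement, so `K * V = S * V`.
  set K : (i : Fin m) → Matrix (Fin (d i)) (Fin (d i)) ℝ :=
    fun i => O i * M i * (O i)ᵀ + t • 1 with hK
  set T := Matrix.blockDiagonal' K - S with hT
  have hKV : Matrix.blockDiagonal' K * V = S * V := by
    refine rowBlock_injective fun i => ?_
    rw [rowBlock_blockDiagonal'_mul, hSO, hV, rowBlock_stack]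
    simp only [hK, hM, Matrix.add_mul, Matrix.mul_assoc, hO1, Matrix.mul_one, Matrix.smul_mul,
      Matrix.one_mul, Matrix.mul_sub, Matrix.mul_smul, sub_add_cancel]
  have hTV : T * V = 0 := by rw [hT, Matrix.sub_mul, hKV, sub_self]
  have hTs : Tᵀ = T := by
    rw [hT, Matrix.transpose_sub, hS.eq, Matrix.blockDiagonal'_transpose]
    congr 2
    ext1 i
    simp only [hK, Matrix.transpose_add, Matrix.transpose_mul, Matrix.transpose_transpose, hMs,
      Matrix.transpose_smul, Matrix.transpose_one, Matrix.mul_assoc]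
  have htrK : ∀ i (B : Matrix (Fin (d i)) (Fin (d i)) ℝ),
      (K i * B).trace = (M i * ((O i)ᵀ * B * O i)).trace + t * B.trace := by
    intro i B
    simp only [hK, Matrix.add_mul, Matrix.trace_add, Matrix.smul_mul, Matrix.one_mul,
      Matrix.trace_smul, smul_eq_mul]
    rw [Matrix.mul_assoc, Matrix.mul_assoc, Matrix.trace_mul_comm, Matrix.mul_assoc]
  have hup : ∀ U' ∈ sdpFeasible d r, (Matrix.blockDiagonal' K * U').trace
      ≤ ∑ i, ((M i).trace + t * r) := by
    rintro U' ⟨-, -, hU'⟩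
    rw [trace_blockDiagonal'_mul]
    refine Finset.sum_le_sum fun i _ => ?_
    rw [htrK, (hU' i).2]
    have h1 := posSemidef_transpose_mul_mul (hU' i).1 (O i)
    rw [Matrix.mul_sub, Matrix.mul_one, Matrix.sub_mul, hO1] at h1
    have h2 := trace_mul_nonneg (hΛ i) h1
    rw [Matrix.mul_sub, Matrix.mul_one, Matrix.trace_sub] at h2
    linarith
  have heq : (S * (V * Vᵀ)).trace = ∑ i, ((M i).trace + t * r) := by
    rw [← Matrix.mul_assoc, ← hKV, Matrix.mul_assoc, trace_blockDiagonal'_mul]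
    refine Finset.sum_congr rfl fun i _ => ?_
    rw [htrK, hV, block_stack_mul_transpose, trace_mul_transpose_of_mem_stiefel (hO i),
      ← Matrix.mul_assoc (O i)ᵀ, hO1, Matrix.one_mul, hO1, Matrix.mul_one]
  -- Weak duality with a quantitative slack: `Z` is the part of `X` orthogonal to the columns of
  -- `V`. As `T` kills `V`, only `Z` contributes to `tr (T X Xᵀ)`, and there `K ≥ t` while `S ≤ t -
  -- κ`.
  have hgap : ∀ X : Matrix (Idx d) (Idx d) ℝ, X * Xᵀ ∈ sdpFeasible d r →
      (S * (X * Xᵀ)).trace + κ * frobNorm (X - V * ((m : ℝ)⁻¹ • (Vᵀ * X))) ^ 2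
        ≤ ∑ i, ((M i).trace + t * r) := by
    intro X hX
    set Z := X - V * ((m : ℝ)⁻¹ • (Vᵀ * X)) with hZ
    have hVZ : Vᵀ * Z = 0 := by
      rw [hZ, Matrix.mul_sub, ← Matrix.mul_assoc, hV, stack_transpose_mul_self hO]
      simp [smul_smul, hm0]
    have hTX : T * X = T * Z := by
      rw [hZ, Matrix.mul_sub, ← Matrix.mul_assoc, hTV, Matrix.zero_mul, sub_zero]
    have hXT : Xᵀ * T = Zᵀ * T := by
      rw [← hTs, ← Matrix.transpose_mul, ← Matrix.transpose_mul, hTX]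
    have h1 : (T * (X * Xᵀ)).trace = (T * (Z * Zᵀ)).trace := by
      rw [← Matrix.mul_assoc, Matrix.trace_mul_comm, ← Matrix.mul_assoc T, Matrix.trace_mul_comm _ Zᵀ,
        hTX, ← Matrix.mul_assoc, hXT, Matrix.mul_assoc]
    have h2 : t * frobNorm Z ^ 2 ≤ (Matrix.blockDiagonal' K * (Z * Zᵀ)).trace := by
      rw [trace_blockDiagonal'_mul, ← trace_transpose_mul_self, Matrix.trace_mul_comm,
        trace_eq_sum_block, Finset.mul_sum]
      refine Finset.sum_le_sum fun i _ => ?_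
      rw [htrK]
      have := trace_mul_nonneg (hΛ i) (posSemidef_transpose_mul_mul
        (posSemidef_block (posSemidef_mul_transpose_self Z) i) (O i))
      linarith
    have h3 := hSZ Z hVZ
    rw [Matrix.trace_mul_comm, Matrix.mul_assoc] at h3
    have h4 := hup _ hX
    simp only [hT, Matrix.sub_mul, Matrix.trace_sub] at h1
    linarith
  have hle : ∀ U' ∈ sdpFeasible d r, (S * U').trace ≤ ∑ i, ((M i).trace + t * r) := by
    intro U' hU'
    obtain ⟨X, rfl⟩ := exists_eq_mul_transpose hU'.2.1
    have h1 := hgap X hU'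
    have h2 : 0 ≤ κ * frobNorm (X - V * ((m : ℝ)⁻¹ • (Vᵀ * X))) ^ 2 := by positivity
    linarith
  rw [IsSDPSolution, hS.eq]
  constructor
  · rintro ⟨hU, hmax⟩
    obtain ⟨X, rfl⟩ := exists_eq_mul_transpose hU.2.1
    have h1 := hgap X hU
    have h2 := hmax _ (stack_mul_transpose_mem_sdpFeasible hO)
    rw [← hV, heq] at h2
    -- An optimal `X Xᵀ` leaves no slack, so `X = V * Y`.
    have h3 : frobNorm (X - V * ((m : ℝ)⁻¹ • (Vᵀ * X))) ^ 2 ≤ 0 := by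
      by_contra! h
      have := mul_pos hκ h
      linarith
    have h4 := frobNorm_eq_zero (pow_eq_zero_iff two_ne_zero |>.1 (le_antisymm h3 (sq_nonneg _)))
    set Y := (m : ℝ)⁻¹ • (Vᵀ * X)
    have hXY : X = V * Y := sub_eq_zero.1 h4
    have hC : X * Xᵀ = V * (Y * Yᵀ) * Vᵀ := by
      rw [hXY, Matrix.transpose_mul]
      simp only [Matrix.mul_assoc]
    -- A single diagonal block suffices: compressed by `O 0`, its constraints say that `1 - Y Yᵀ` is
    -- positive semidefinite with trace zero.
    have hone : 1 - Y * Yᵀ = 0 := by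
      have hi := hU.2.2 ⟨0, hm⟩
      rw [hC, hV, block_stack_conj] at hi
      have h5 := posSemidef_transpose_mul_mul hi.1 (O ⟨0, hm⟩)
      have h6 : (O ⟨0, hm⟩)ᵀ * (1 - O ⟨0, hm⟩ * (Y * Yᵀ) * (O ⟨0, hm⟩)ᵀ) * O ⟨0, hm⟩
          = 1 - Y * Yᵀ := by
        rw [Matrix.mul_sub, Matrix.sub_mul, Matrix.mul_one, hO1, Matrix.mul_assoc, Matrix.mul_assoc,
          hO1, Matrix.mul_one, ← Matrix.mul_assoc, hO1, Matrix.one_mul]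
      rw [h6] at h5
      refine h5.trace_eq_zero_iff.1 ?_
      have h7 := hi.2
      rw [Matrix.mul_assoc, Matrix.trace_mul_comm, Matrix.mul_assoc, hO1, Matrix.mul_one] at h7
      rw [Matrix.trace_sub, h7]
      simp
    rw [hC, ← sub_eq_zero.1 hone, Matrix.mul_one]
  · rintro rfl
    refine ⟨stack_mul_transpose_mem_sdpFeasible hO, fun U' hU' => ?_⟩
    rw [heq]
    exact hle U' hU'

end Certificate

/-! ### Existence and first order conditions for the trace-sum problem -/

section Solutions

variable {m r : ℕ} {d : Fin m → ℕ} {Θ O : (i : Fin m) → Matrix (Fin (d i)) (Fin r) ℝ}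
  {W : Matrix (Idx d) (Idx d) ℝ}

lemma isSymm_dataMatrix (hW : W.IsSymm) : (dataMatrix Θ W).IsSymm := by
  rw [dataMatrix_eq, Matrix.IsSymm, Matrix.transpose_add, hW.eq]
  simp

lemma trace_dataMatrix_conj {l : Type} [Fintype l] (X : Matrix (Idx d) l ℝ) :
    (Xᵀ * (dataMatrix Θ W * X)).trace
      = frobNorm ((stack Θ)ᵀ * X) ^ 2 + (Xᵀ * (W * X)).trace := by
  rw [dataMatrix_eq, ← trace_transpose_mul_self, ← Matrix.trace_add]
  congr 1
  simp only [Matrix.transpose_mul, Matrix.transpose_transpose, Matrix.add_mul, Matrix.mul_add,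
    Matrix.mul_assoc]

lemma rowBlock_dataMatrix_mul (Y : Matrix (Idx d) (Fin r) ℝ) (i : Fin m) :
    rowBlock (dataMatrix Θ W * Y) i = Θ i * ((stack Θ)ᵀ * Y) + rowBlock (W * Y) i := by
  rw [dataMatrix_eq, Matrix.add_mul, rowBlock_add, Matrix.mul_assoc, rowBlock_stack_mul]

lemma trace_symm_conj_add {S : Matrix (Idx d) (Idx d) ℝ} (hS : S.IsSymm)
    (V E : Matrix (Idx d) (Fin r) ℝ) :
    ((V + E)ᵀ * (S * (V + E))).trace
      = (Vᵀ * (S * V)).trace + 2 * (Eᵀ * (S * V)).trace + (Eᵀ * (S * E)).trace := by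
  have h : (Vᵀ * (S * E)).trace = (Eᵀ * (S * V)).trace := by
    rw [← Matrix.trace_transpose, Matrix.transpose_mul, Matrix.transpose_mul, hS.eq,
      Matrix.transpose_transpose, Matrix.mul_assoc]
  simp only [Matrix.transpose_add, Matrix.add_mul, Matrix.mul_add, Matrix.trace_add, h]
  ring

lemma trace_stack_single_transpose_mul (i : Fin m) (Δ : Matrix (Fin (d i)) (Fin r) ℝ)
    (Y : Matrix (Idx d) (Fin r) ℝ) :
    ((stack (Pi.single (M := fun i => Matrix (Fin (d i)) (Fin r) ℝ) i Δ))ᵀ * Y).trace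
      = (Δᵀ * rowBlock Y i).trace := by
  rw [trace_stack_transpose_mul, Finset.sum_eq_single i (fun j _ hj => by
    rw [Pi.single_eq_of_ne hj]; simp) (by simp), Pi.single_eq_same]

/-- Changing a single block of a solution does not increase the objective. -/
lemma IsTraceSumSolution.two_mul_trace_le (hW : W.IsSymm)
    (hO : IsTraceSumSolution (dataMatrix Θ W) O) (i : Fin m)
    {O' : Matrix (Fin (d i)) (Fin r) ℝ} (hO' : O' ∈ stiefel (d i) r) :
    2 * ((O' - O i)ᵀ * rowBlock (dataMatrix Θ W * stack O) i).trace
      ≤ opNorm W * frobNorm (O' - O i) ^ 2 := by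
  set E := stack (Pi.single (M := fun i => Matrix (Fin (d i)) (Fin r) ℝ) i (O' - O i)) with hE
  have hst : stack (Function.update O i O') = stack O + E := by
    refine rowBlock_injective fun j => ?_
    rw [rowBlock_add, hE, rowBlock_stack, rowBlock_stack, rowBlock_stack]
    rcases eq_or_ne j i with rfl | hj
    · simp
    · simp [hj]
  have hEn : frobNorm E ^ 2 = frobNorm (O' - O i) ^ 2 := by
    rw [← trace_transpose_mul_self, hE, trace_stack_single_transpose_mul, rowBlock_stack,
      Pi.single_eq_same, trace_transpose_mul_self]
  have h := hO.2 (Function.update O i O') fun j => by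
    rcases eq_or_ne j i with rfl | hj
    · simpa using hO'
    · simpa [hj] using hO.1 j
  rw [traceSum_eq, traceSum_eq, hst, trace_symm_conj_add (isSymm_dataMatrix hW),
    trace_dataMatrix_conj E, hE, trace_stack_single_transpose_mul, ← hE] at h
  have h2 := (abs_le.1 (abs_trace_conj_le_opNorm W E E)).1
  rw [Matrix.mul_assoc, mul_assoc, ← sq, hEn] at h2
  -- The signal part of the second order term is nonnegative and can be dropped; only the noise part
  -- costs `opNorm W`.
  have h3 : 0 ≤ frobNorm ((stack Θ)ᵀ * E) ^ 2 := sq_nonneg _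
  linarith

/-- On the Stiefel manifold `‖O' - O i‖² = 2r - 2 tr (O'ᵀ O i)`, so the quadratic error in
`two_mul_trace_le` is linear in `O'`. Thus `O i` maximizes a linear form whose matrix is `B` shifted
by `opNorm W • O i`, and the shift does not affect the conclusion. -/
lemma IsTraceSumSolution.stationary (hW : W.IsSymm)
    (hO : IsTraceSumSolution (dataMatrix Θ W) O) (i : Fin m) :
    ((O i)ᵀ * rowBlock (dataMatrix Θ W * stack O) i).IsSymm ∧
      rowBlock (dataMatrix Θ W * stack O) i
        = O i * ((O i)ᵀ * rowBlock (dataMatrix Θ W * stack O) i) := by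
  set B := rowBlock (dataMatrix Θ W * stack O) i with hB
  have hOi : (O i)ᵀ * O i = 1 := hO.1 i
  have hmax : ∀ O' ∈ stiefel (d i) r,
      (O'ᵀ * (B + opNorm W • O i)).trace ≤ ((O i)ᵀ * (B + opNorm W • O i)).trace := by
    intro O' hO'
    have h := hO.two_mul_trace_le hW i hO'
    have h1 : O'ᵀ * O' = 1 := hO'
    rw [← trace_transpose_mul_self, ← hB] at h
    simp only [Matrix.transpose_sub, Matrix.sub_mul, Matrix.mul_sub, Matrix.trace_sub, h1,
      hOi, trace_transpose_mul_comm (O i) O'] at h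
    simp only [Matrix.mul_add, Matrix.trace_add, Matrix.mul_smul, Matrix.trace_smul, smul_eq_mul,
      hOi]
    linarith
  obtain ⟨h1, h2⟩ := eq_mul_of_isMax (hO.1 i) hmax
  rw [Matrix.mul_add, Matrix.mul_smul, hOi] at h1 h2
  constructor
  · have := h1.sub (Matrix.isSymm_one.smul (opNorm W))
    simpa using this
  · rw [Matrix.mul_add, Matrix.mul_smul, Matrix.mul_one] at h2
    exact add_right_cancel h2

lemma exists_isTraceSumSolution (hΘ : ∀ i, Θ i ∈ stiefel (d i) r)
    (S : Matrix (Idx d) (Idx d) ℝ) : ∃ O : (i : Fin m) → Matrix (Fin (d i)) (Fin r) ℝ,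
      IsTraceSumSolution S O ∧ ((stack Θ)ᵀ * stack O).PosSemidef := by
  obtain ⟨O, hO, hmax⟩ := (isCompact_univ_pi fun i : Fin m =>
    isCompact_stiefel (n := d i) (r := r)).exists_isMaxOn ⟨Θ, fun i _ => hΘ i⟩
    (f := fun O => traceSum S O) (by unfold traceSum; fun_prop)
  -- The objective depends only on `V Vᵀ`, so a common rotation of the blocks is free; it is spent
  -- on aligning `V` with `Θ`.
  obtain ⟨Q, hQ, hP⟩ := exists_polar ((stack O)ᵀ * stack Θ)
  have hst : stack (fun i => O i * Q) = stack O * Q := rfl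
  refine ⟨fun i => O i * Q, ⟨fun i => mem_stiefel_mul (hO i trivial) hQ, fun O' hO' => ?_⟩, ?_⟩
  · have h : traceSum S (fun i => O i * Q) = traceSum S O := by
      rw [traceSum_eq_trace_mul, traceSum_eq_trace_mul, hst, Matrix.transpose_mul,
        Matrix.mul_assoc, ← Matrix.mul_assoc Q, mul_eq_one_comm.1 hQ, Matrix.one_mul]
    rw [h]
    exact hmax fun i _ => hO' i
  · have := hP.transpose
    rw [hst]
    simpa [Matrix.mul_assoc] using this

end Solutions

/-! ### Distance of an aligned solution to the signal -/

section Estimates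

variable {m r : ℕ} {d : Fin m → ℕ} {Θ O : (i : Fin m) → Matrix (Fin (d i)) (Fin r) ℝ}
  {W : Matrix (Idx d) (Idx d) ℝ}

/-- Polarization: both Gram matrices equal `m I`, and positivity makes the cross term symmetric, so
the two cross terms in the Gram matrix of the difference coincide. -/
lemma transpose_mul_eq_of_posSemidef (hΘ : ∀ i, Θ i ∈ stiefel (d i) r)
    (hO : ∀ i, O i ∈ stiefel (d i) r) (hP : ((stack Θ)ᵀ * stack O).PosSemidef) :
    (stack Θ)ᵀ * stack O
      = (m : ℝ) • 1 - (1 / 2 : ℝ) • ((stack O - stack Θ)ᵀ * (stack O - stack Θ)) := by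
  have h : (stack O)ᵀ * stack Θ = (stack Θ)ᵀ * stack O := by
    have := hP.isHermitian.eq
    rwa [Matrix.conjTranspose_eq_transpose_of_trivial, Matrix.transpose_mul,
      Matrix.transpose_transpose] at this
  simp only [Matrix.transpose_sub, Matrix.sub_mul, Matrix.mul_sub, stack_transpose_mul_self hΘ,
    stack_transpose_mul_self hO, h]
  module

lemma frobNorm_stack (hO : ∀ i, O i ∈ stiefel (d i) r) : frobNorm (stack O) = √(m * r) := by
  rw [← Real.sqrt_sq (frobNorm_nonneg (stack O)), ← trace_transpose_mul_self,
    stack_transpose_mul_self hO]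
  simp

/-- Comparing the values at `V` and `Θ`, the signal loses at least `m ‖E‖² / 2`, while the noise
gains `tr (Eᵀ W (V + Θ)) ≤ 2 ‖W‖ ‖E‖ √(m r)`. Divide by `‖E‖`. -/
lemma IsTraceSumSolution.mul_frobNorm_sub_le (hW : W.IsSymm) (hΘ : ∀ i, Θ i ∈ stiefel (d i) r)
    (hO : IsTraceSumSolution (dataMatrix Θ W) O) (hP : ((stack Θ)ᵀ * stack O).PosSemidef) :
    m * frobNorm (stack O - stack Θ) ≤ 4 * opNorm W * √(m * r) := by
  set V := stack O with hV
  set T := stack Θ with hT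
  set E := V - T with hE
  have hPE : Tᵀ * V = (m : ℝ) • 1 - (1 / 2 : ℝ) • (Eᵀ * E) :=
    transpose_mul_eq_of_posSemidef hΘ hO.1 hP
  have hPs : (Tᵀ * V)ᵀ = Tᵀ * V := by
    rw [← Matrix.conjTranspose_eq_transpose_of_trivial]
    exact hP.isHermitian.eq
  have h1 : frobNorm (Tᵀ * V) ^ 2 ≤ m * (m * r - frobNorm E ^ 2 / 2) := by
    -- Expanding one factor of `P² = P (m I - EᵀE / 2)` and dropping `tr (P EᵀE) ≥ 0` gives `‖P‖² ≤
    -- m tr P`.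
    have h2 : 0 ≤ ((Tᵀ * V) * (Eᵀ * E)).trace :=
      trace_mul_nonneg hP (by simpa using posSemidef_mul_transpose_self Eᵀ)
    have h3 : (Tᵀ * V).trace = m * r - frobNorm E ^ 2 / 2 := by
      rw [hPE, ← trace_transpose_mul_self]
      simp
      ring
    rw [← trace_transpose_mul_self, hPs]
    nth_rw 2 [hPE]
    rw [Matrix.mul_sub, Matrix.trace_sub, Matrix.mul_smul, Matrix.mul_smul, Matrix.mul_one,
      Matrix.trace_smul, Matrix.trace_smul, smul_eq_mul, smul_eq_mul, h3]
    linarith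
  have h4 : frobNorm (Tᵀ * T) ^ 2 = m * (m * r) := by
    rw [hT, stack_transpose_mul_self hΘ, ← trace_transpose_mul_self]
    simp
  have h5 := hO.2 Θ hΘ
  rw [traceSum_eq, traceSum_eq, trace_dataMatrix_conj, trace_dataMatrix_conj, ← hT, ← hV, h4] at h5
  have h6 : (Vᵀ * (W * V)).trace - (Tᵀ * (W * T)).trace = (Eᵀ * W * (V + T)).trace := by
    have h : (Vᵀ * (W * T)).trace = (Tᵀ * (W * V)).trace := by
      rw [← Matrix.trace_transpose, Matrix.transpose_mul, Matrix.transpose_mul, hW.eq,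
        Matrix.transpose_transpose, Matrix.mul_assoc]
    simp only [hE, Matrix.transpose_sub, Matrix.sub_mul, Matrix.mul_add, Matrix.trace_add,
      Matrix.trace_sub, Matrix.mul_assoc, h]
    ring
  have h7 : frobNorm (V + T) ≤ 2 * √(m * r) := by
    have := frobNorm_add_le V T
    rw [hV, hT, frobNorm_stack hΘ, frobNorm_stack hO.1] at this
    linarith
  have h8 := (abs_le.1 (abs_trace_conj_le_opNorm W E (V + T))).2
  have h9 : opNorm W * frobNorm E * frobNorm (V + T)
      ≤ opNorm W * frobNorm E * (2 * √(m * r)) :=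
    mul_le_mul_of_nonneg_left h7 (mul_nonneg (opNorm_nonneg W) (frobNorm_nonneg E))
  have h10 : frobNorm E * (m * frobNorm E) ≤ frobNorm E * (4 * opNorm W * √(m * r)) := by
    nlinarith
  rcases (frobNorm_nonneg E).eq_or_lt with h0 | h0
  · rw [← h0, mul_zero]
    exact mul_nonneg (mul_nonneg zero_le_four (opNorm_nonneg W)) (Real.sqrt_nonneg _)
  · exact le_of_mul_le_mul_left h10 h0

/-- The competitor replaces block `i` by `Θ i`. The signal's share of the resulting inequality is
`tr (δᵀ δ P)`, because `δᵀδ = -(δᵀΘ_i) - Θ_iᵀδ` and `P` is symmetric; it is at least `(m - ‖E‖² / 2)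
‖δ‖²`. -/
lemma IsTraceSumSolution.mul_frobNorm_block_sub_le (hW : W.IsSymm)
    (hΘ : ∀ i, Θ i ∈ stiefel (d i) r) (hO : IsTraceSumSolution (dataMatrix Θ W) O)
    (hP : ((stack Θ)ᵀ * stack O).PosSemidef) (i : Fin m) :
    (m - frobNorm (stack O - stack Θ) ^ 2 / 2 - opNorm W) * frobNorm (O i - Θ i)
      ≤ 2 * frobNorm (rowBlock (W * stack O) i) := by
  set E := stack O - stack Θ with hE
  set P := (stack Θ)ᵀ * stack O with hPdef
  set N := rowBlock (W * stack O) i with hN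
  set δ := O i - Θ i with hδ
  have hPE : P = (m : ℝ) • 1 - (1 / 2 : ℝ) • (Eᵀ * E) :=
    transpose_mul_eq_of_posSemidef hΘ hO.1 hP
  have hPs : Pᵀ = P := by
    rw [← Matrix.conjTranspose_eq_transpose_of_trivial]
    exact hP.isHermitian.eq
  have h1 := hO.two_mul_trace_le hW i (hΘ i)
  rw [rowBlock_dataMatrix_mul, ← hPdef, ← hN, ← neg_sub, ← hδ] at h1
  have hn : frobNorm (-δ) = frobNorm δ := by
    rw [← neg_one_smul ℝ δ, frobNorm_smul]; simp
  rw [hn, Matrix.transpose_neg, Matrix.neg_mul, Matrix.trace_neg, Matrix.mul_add,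
    Matrix.trace_add] at h1
  have h2 : δᵀ * δ = -(δᵀ * Θ i) - (Θ i)ᵀ * δ := by
    have ha : (O i)ᵀ * O i = 1 := hO.1 i
    have hb : (Θ i)ᵀ * Θ i = 1 := hΘ i
    rw [hδ]
    simp only [Matrix.transpose_sub, Matrix.sub_mul, Matrix.mul_sub, ha, hb]
    abel
  have h3 : ((Θ i)ᵀ * δ * P).trace = (δᵀ * (Θ i * P)).trace := by
    rw [← Matrix.trace_transpose, Matrix.transpose_mul _ P, Matrix.transpose_mul (Θ i)ᵀ δ, hPs,
      Matrix.transpose_transpose, Matrix.trace_mul_comm, Matrix.mul_assoc]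
  have h4 : (δᵀ * δ * P).trace = -2 * (δᵀ * (Θ i * P)).trace := by
    rw [h2, Matrix.sub_mul, Matrix.trace_sub, h3, Matrix.neg_mul, Matrix.trace_neg,
      Matrix.mul_assoc]
    ring
  have h5 : (δᵀ * δ * P).trace = m * frobNorm δ ^ 2 - frobNorm (E * δᵀ) ^ 2 / 2 := by
    have h6 : (δᵀ * δ * (Eᵀ * E)).trace = frobNorm (E * δᵀ) ^ 2 := by
      rw [← trace_transpose_mul_self, Matrix.transpose_mul, Matrix.transpose_transpose,
        Matrix.mul_assoc, Matrix.trace_mul_comm]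
      simp only [Matrix.mul_assoc]
    rw [hPE, Matrix.mul_sub, Matrix.trace_sub, Matrix.mul_smul, Matrix.mul_smul, Matrix.mul_one,
      Matrix.trace_smul, Matrix.trace_smul, smul_eq_mul, smul_eq_mul, h6,
      trace_transpose_mul_self]
    ring
  have h7 : frobNorm (E * δᵀ) ^ 2 ≤ frobNorm E ^ 2 * frobNorm δ ^ 2 := by
    rw [← mul_pow, ← frobNorm_transpose δ]
    exact pow_le_pow_left₀ (frobNorm_nonneg _) (frobNorm_mul_le _ _) 2
  have h8 := trace_transpose_mul_le δ N
  have h9 : frobNorm δ * ((m - frobNorm E ^ 2 / 2 - opNorm W) * frobNorm δ)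
      ≤ frobNorm δ * (2 * frobNorm N) := by nlinarith
  rcases (frobNorm_nonneg δ).eq_or_lt with h0 | h0
  · rw [← h0, mul_zero]
    exact mul_nonneg zero_le_two (frobNorm_nonneg N)
  · exact le_of_mul_le_mul_left h9 h0

/-- Substituting `Θ i = O i - δ` writes the multiplier as `P - O_iᵀ δ P + O_iᵀ N`, where `P` differs
from `m I` by `EᵀE / 2`. -/
lemma frobNorm_multiplier_sub_le (hΘ : ∀ i, Θ i ∈ stiefel (d i) r)
    (hO : ∀ i, O i ∈ stiefel (d i) r) (hP : ((stack Θ)ᵀ * stack O).PosSemidef) (i : Fin m) :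
    frobNorm ((O i)ᵀ * rowBlock (dataMatrix Θ W * stack O) i - (m : ℝ) • 1)
      ≤ frobNorm (stack O - stack Θ) ^ 2 / 2
        + frobNorm (O i - Θ i) * (m + frobNorm (stack O - stack Θ) ^ 2 / 2)
        + frobNorm (rowBlock (W * stack O) i) := by
  rw [rowBlock_dataMatrix_mul]
  set E := stack O - stack Θ with hE
  set P := (stack Θ)ᵀ * stack O with hPdef
  set N := rowBlock (W * stack O) i with hN
  set δ := O i - Θ i with hδ
  have hPE : P = (m : ℝ) • 1 - (1 / 2 : ℝ) • (Eᵀ * E) :=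
    transpose_mul_eq_of_posSemidef hΘ hO hP
  have ha : (O i)ᵀ * O i = 1 := hO i
  have h1 : (O i)ᵀ * (Θ i * P + N) - (m : ℝ) • 1
      = (O i)ᵀ * N - ((1 / 2 : ℝ) • (Eᵀ * E)
        + (O i)ᵀ * ((m : ℝ) • δ - (1 / 2 : ℝ) • (δ * (Eᵀ * E)))) := by
    have h2 : (m : ℝ) • δ - (1 / 2 : ℝ) • (δ * (Eᵀ * E)) = δ * P := by
      rw [hPE, Matrix.mul_sub δ, Matrix.mul_smul, Matrix.mul_smul, Matrix.mul_one]
    have h3 : (1 / 2 : ℝ) • (Eᵀ * E) = (m : ℝ) • 1 - P := by rw [hPE]; abel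
    rw [h2, h3, hδ, Matrix.sub_mul, Matrix.mul_sub, ← Matrix.mul_assoc _ (O i), ha,
      Matrix.one_mul, Matrix.mul_add]
    abel
  have h4 : frobNorm (Eᵀ * E) ≤ frobNorm E ^ 2 := by
    have := frobNorm_mul_le Eᵀ E
    rwa [frobNorm_transpose, ← sq] at this
  have h5 : frobNorm ((m : ℝ) • δ - (1 / 2 : ℝ) • (δ * (Eᵀ * E)))
      ≤ frobNorm δ * (m + frobNorm E ^ 2 / 2) := by
    refine (frobNorm_sub_le _ _).trans ?_
    rw [frobNorm_smul, frobNorm_smul, abs_of_nonneg (Nat.cast_nonneg m),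
      abs_of_nonneg (by norm_num : (0 : ℝ) ≤ 1 / 2)]
    have h6 := (frobNorm_mul_le δ (Eᵀ * E)).trans
      (mul_le_mul_of_nonneg_left h4 (frobNorm_nonneg δ))
    linarith
  rw [h1]
  refine (frobNorm_sub_le _ _).trans ?_
  have h7 := frobNorm_add_le ((1 / 2 : ℝ) • (Eᵀ * E))
    ((O i)ᵀ * ((m : ℝ) • δ - (1 / 2 : ℝ) • (δ * (Eᵀ * E))))
  rw [frobNorm_smul, abs_of_nonneg (by norm_num : (0 : ℝ) ≤ 1 / 2)] at h7
  have h8 := frobNorm_transpose_mul_le_of_mem_stiefel (hO i) N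
  have h9 := frobNorm_transpose_mul_le_of_mem_stiefel (hO i)
    ((m : ℝ) • δ - (1 / 2 : ℝ) • (δ * (Eᵀ * E)))
  linarith

/-- Since `Z` is orthogonal to `V`, `Θᵀ Z = -Eᵀ Z`: the signal sees `Z` only through the small error
`E`. -/
lemma trace_dataMatrix_conj_le {l : Type} [Fintype l] (Z : Matrix (Idx d) l ℝ)
    (hZ : (stack O)ᵀ * Z = 0) :
    (Zᵀ * (dataMatrix Θ W * Z)).trace
      ≤ (frobNorm (stack O - stack Θ) ^ 2 + opNorm W) * frobNorm Z ^ 2 := by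
  have h1 : (stack Θ)ᵀ * Z = -((stack O - stack Θ)ᵀ * Z) := by
    rw [Matrix.transpose_sub, Matrix.sub_mul, hZ, zero_sub, neg_neg]
  have h2 : frobNorm ((stack Θ)ᵀ * Z) ≤ frobNorm (stack O - stack Θ) * frobNorm Z := by
    rw [h1, ← neg_one_smul ℝ, frobNorm_smul, abs_neg, abs_one, one_mul,
      ← frobNorm_transpose (stack O - stack Θ)]
    exact frobNorm_mul_le _ _
  have h3 := pow_le_pow_left₀ (frobNorm_nonneg _) h2 2
  have h4 := (abs_le.1 (abs_trace_conj_le_opNorm W Z Z)).2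
  rw [Matrix.mul_assoc] at h4
  rw [trace_dataMatrix_conj]
  linarith

end Estimates

/-! ### Numerical consequences of discordance -/

section Numerics

/-- Tangent line of the logarithm at `e`, applied to `√x`: `log x ≤ (2 / e) √x`, and `2 / e < 0.736
< 0.858²`. -/
lemma sqrt_log_le {x : ℝ} (hx : 0 < x) : √(Real.log x) ≤ 0.858 * √(√x) := by
  have hs : 0 < √x := Real.sqrt_pos.2 hx
  have h1 : Real.log (√x / Real.exp 1) ≤ √x / Real.exp 1 - 1 :=
    Real.log_le_sub_one_of_pos (by positivity)
  rw [Real.log_div hs.ne' (Real.exp_ne_zero 1), Real.log_exp, Real.log_sqrt hx.le] at h1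
  have h2 : √x / Real.exp 1 ≤ √x * 0.368 := by
    rw [div_le_iff₀ (Real.exp_pos 1), mul_assoc]
    refine le_mul_of_one_le_right hs.le ?_
    linarith [Real.exp_one_gt_d9]
  apply Real.sqrt_le_iff.2 ⟨by positivity, ?_⟩
  rw [mul_pow, Real.sq_sqrt hs.le]
  linarith

variable {m r : ℕ} {d : Fin m → ℕ} {Θ : (i : Fin m) → Matrix (Fin (d i)) (Fin r) ℝ}
  {W : Matrix (Idx d) (Idx d) ℝ}

lemma le_iSup_frobNorm_rowBlock (Y : Matrix (Idx d) (Fin r) ℝ) (i : Fin m) :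
    frobNorm (rowBlock Y i) ≤ ⨆ i, frobNorm (rowBlock Y i) :=
  le_ciSup (f := fun i => frobNorm (rowBlock Y i)) (Set.finite_range _).bddAbove i

lemma iSup_frobNorm_rowBlock_smul (c : ℝ) (hc : 0 ≤ c) (Y : Matrix (Idx d) (Fin r) ℝ) :
    ⨆ i, frobNorm (rowBlock (c • Y) i) = c * ⨆ i, frobNorm (rowBlock Y i) := by
  rw [Real.mul_iSup_of_nonneg hc]
  simp only [rowBlock_smul, frobNorm_smul, abs_of_nonneg hc]

/-- Bounds for the noise in terms of `u = m ^ (1 / 4)`. -/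
lemma noise_bounds {u : ℝ} (hu : 0 < u) (hum : u ^ 4 = m) (hr : 1 ≤ r)
    {σ : ℝ} (hσ : 0 < σ)
    (hW : IsDiscordant Θ (σ⁻¹ • W))
    (hσ_le : σ ≤ u / (60 * √(((∑ i, d i : ℕ) : ℝ) / m * r))) :
    opNorm W * √r ≤ u ^ 3 / 20 ∧
      ⨆ i, frobNorm (rowBlock (W * stack Θ) i) ≤ 0.0429 * u ^ 4 := by
  have hm : (0 : ℝ) < m := by rw [← hum]; positivity
  have hrR : (0 : ℝ) < r := by exact_mod_cast hr
  have hu2 : √(m : ℝ) = u ^ 2 := by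
    rw [← hum, show u ^ 4 = (u ^ 2) ^ 2 by ring, Real.sqrt_sq (by positivity)]
  set D : ℝ := ((∑ i, d i : ℕ) : ℝ) with hD
  have hDr : σ * (√D * √r) ≤ u ^ 3 / 60 := by
    -- For `D = 0` the bound on `σ` involves a division by zero, but the claim is then trivial.
    rcases (show (0 : ℝ) ≤ D from Nat.cast_nonneg _).eq_or_lt with h0 | h0
    · rw [← h0, Real.sqrt_zero]
      simp only [zero_mul, mul_zero]
      positivity
    · have h1 : √(D / m * r) = √D * √r / u ^ 2 := by
        rw [Real.sqrt_mul (by positivity), Real.sqrt_div h0.le, hu2]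
        ring
      rw [h1, le_div_iff₀ (by positivity)] at hσ_le
      have h2 : σ * (√D * √r) = σ * (60 * (√D * √r / u ^ 2)) * (u ^ 2 / 60) := by
        field_simp
      rw [h2]
      calc _ ≤ u * (u ^ 2 / 60) := mul_le_mul_of_nonneg_right hσ_le (by positivity)
        _ = _ := by ring
  have hop := hW.opNorm_le
  have hsup := hW.sup_frobNorm_le
  rw [opNorm_smul, abs_of_pos (inv_pos.2 hσ), inv_mul_le_iff₀ hσ] at hop
  rw [Matrix.smul_mul, iSup_frobNorm_rowBlock_smul _ (inv_pos.2 hσ).le, inv_mul_le_iff₀ hσ,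
    Real.sqrt_mul (by positivity), Real.sqrt_mul (by positivity), ← hD] at hsup
  constructor
  · calc opNorm W * √r ≤ σ * (3 * √D) * √r :=
        mul_le_mul_of_nonneg_right hop (Real.sqrt_nonneg _)
      _ = 3 * (σ * (√D * √r)) := by ring
      _ ≤ _ := by linarith
  · have hlog := sqrt_log_le hm
    rw [hu2, Real.sqrt_sq hu.le] at hlog
    calc _ ≤ σ * (3 * (√D * √r * √(Real.log m))) := hsup
      _ = 3 * (σ * (√D * √r)) * √(Real.log m) := by ring
      _ ≤ 3 * (u ^ 3 / 60) * (0.858 * u) := by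
        refine mul_le_mul (by linarith) hlog (Real.sqrt_nonneg _) (by positivity)
      _ = _ := by ring

lemma noiseTerm_le {u : ℝ} (hu : 0 < u) (hum : u ^ 4 = m) (hr : 1 ≤ r)
    (hω : opNorm W * √r ≤ u ^ 3 / 20)
    (hB : ⨆ i, frobNorm (rowBlock (W * stack Θ) i) ≤ 0.0429 * u ^ 4) :
    noiseTerm Θ W ≤ 0.0529 * u ^ 4 := by
  have hu2 : √(m : ℝ) = u ^ 2 := by
    rw [← hum, show u ^ 4 = (u ^ 2) ^ 2 by ring, Real.sqrt_sq (by positivity)]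
  have hr1 : 1 ≤ √(r : ℝ) := Real.one_le_sqrt.2 (by exact_mod_cast hr)
  have hω0 := opNorm_nonneg W
  have h1 : opNorm W ^ 2 * √r ≤ (u ^ 3 / 20) ^ 2 := by
    calc opNorm W ^ 2 * √r ≤ opNorm W ^ 2 * √r * √r :=
          le_mul_of_one_le_right (by positivity) hr1
      _ = (opNorm W * √r) ^ 2 := by ring
      _ ≤ _ := pow_le_pow_left₀ (by positivity) hω 2
  have h2 : 4 * opNorm W ^ 2 * √((r : ℝ) / m) ≤ 0.01 * u ^ 4 := by
    rw [Real.sqrt_div (by positivity), hu2, mul_div_assoc', div_le_iff₀ (by positivity)]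
    nlinarith
  rw [noiseTerm]
  linarith

lemma noiseCondition_of_bounds {u : ℝ} (hu : 1.68 ≤ u) (hum : u ^ 4 = m) (hm : 8 ≤ m)
    (hr : 1 ≤ r) (hω : opNorm W * √r ≤ u ^ 3 / 20)
    (hA : noiseTerm Θ W ≤ 0.0529 * u ^ 4) : NoiseCondition Θ W := by
  have hu0 : 0 < u := by linarith
  have hu2 : √(m : ℝ) = u ^ 2 := by
    rw [← hum, show u ^ 4 = (u ^ 2) ^ 2 by ring, Real.sqrt_sq (by positivity)]
  have hr1 : 1 ≤ √(r : ℝ) := Real.one_le_sqrt.2 (by exact_mod_cast hr)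
  have hω1 : opNorm W ≤ u ^ 3 / 20 :=
    (le_mul_of_one_le_right (opNorm_nonneg W) hr1).trans hω
  have hm8 : (8 : ℝ) ≤ m := by exact_mod_cast hm
  have hu4 : 1.68 * u ^ 3 ≤ u ^ 4 := by
    rw [pow_succ' u 3]
    exact mul_le_mul_of_nonneg_right hu (by positivity)
  have hu3 : 2.82 * u ≤ u ^ 3 := by
    rw [show u ^ 3 = u ^ 2 * u by ring]
    refine mul_le_mul_of_nonneg_right ?_ hu0.le
    nlinarith
  -- The product is at most `5 u³ / 20 ≤ m / 6.72`, and `1 ≤ m / 8`.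
  have hden : 0.7261 * (m : ℝ) ≤ m - opNorm W * (4 * √r + 1) - 1 := by
    have : opNorm W * (4 * √r + 1) ≤ u ^ 3 / 4 := by linarith
    linarith
  refine ⟨by linarith, ?_⟩
  have h1 : 2 * noiseTerm Θ W / (m - opNorm W * (4 * √r + 1) - 1) ≤ 0.1458 := by
    rw [div_le_iff₀ (by linarith)]
    linarith
  have h2 : 8 * opNorm W * √((r : ℝ) / m) ≤ 0.4 * u := by
    rw [Real.sqrt_div (by positivity), hu2, mul_div_assoc', div_le_iff₀ (by positivity)]
    nlinarith
  have h3 : 4 * (m : ℝ) * (2 * noiseTerm Θ W / (m - opNorm W * (4 * √r + 1) - 1))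
      ≤ 4 * m * 0.1458 := mul_le_mul_of_nonneg_left h1 (by positivity)
  linarith

end Numerics

/-! ### Uniqueness for the relaxation and tightness -/

section Tightness

variable {m r : ℕ} {d : Fin m → ℕ} {Θ O : (i : Fin m) → Matrix (Fin (d i)) (Fin r) ℝ}
  {W : Matrix (Idx d) (Idx d) ℝ}

lemma isSDPSolution_iff_eq_stack (hm : 0 < m) (hr : 1 ≤ r) (hW : W.IsSymm)
    (hΘ : ∀ i, Θ i ∈ stiefel (d i) r) (hω : opNorm W * √r ≤ 0.03 * m)
    (hA : noiseTerm Θ W ≤ 0.0529 * m)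
    (hO : IsTraceSumSolution (dataMatrix Θ W) O) (hP : ((stack Θ)ᵀ * stack O).PosSemidef)
    (U : Matrix (Idx d) (Idx d) ℝ) :
    IsSDPSolution r (dataMatrix Θ W) U ↔ U = stack O * (stack O)ᵀ := by
  have hmR : (0 : ℝ) < m := by exact_mod_cast hm
  have hsm : 0 < √(m : ℝ) := Real.sqrt_pos.2 hmR
  have hsm2 : √(m : ℝ) * √m = m := Real.mul_self_sqrt hmR.le
  have hω0 := opNorm_nonneg W
  have hr1 : 1 ≤ √(r : ℝ) := Real.one_le_sqrt.2 (by exact_mod_cast hr)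
  have hω1 : opNorm W ≤ 0.03 * m := (le_mul_of_one_le_right hω0 hr1).trans hω
  set ε := frobNorm (stack O - stack Θ) with hε
  have hε0 : 0 ≤ ε := frobNorm_nonneg _
  have hε1 : ε ≤ 4 * opNorm W * √((r : ℝ) / m) := by
    have h := hO.mul_frobNorm_sub_le hW hΘ hP
    rw [Real.sqrt_mul hmR.le, ← hε] at h
    rw [Real.sqrt_div (by positivity), mul_div_assoc', le_div_iff₀ hsm]
    refine le_of_mul_le_mul_left ?_ hsm
    calc √(m : ℝ) * (ε * √m) = √m * √m * ε := by ring
      _ = m * ε := by rw [hsm2]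
      _ ≤ _ := h
      _ = _ := by ring
  have hε2 : ε ^ 2 ≤ 0.0144 * m := by
    have h1 : ε * √m ≤ 0.12 * m := by
      rw [Real.sqrt_div (by positivity), mul_div_assoc', le_div_iff₀ hsm] at hε1
      linarith
    have h2 : (ε * √m) ^ 2 ≤ (0.12 * m) ^ 2 := pow_le_pow_left₀ (by positivity) h1 2
    rw [mul_pow, Real.sq_sqrt hmR.le] at h2
    refine le_of_mul_le_mul_right ?_ hmR
    linarith
  have hN : ∀ i, frobNorm (rowBlock (W * stack O) i) ≤ 0.0529 * m := by
    intro i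
    -- The second summand is bounded crudely by `‖W‖ ‖E‖`, which is exactly where the second term of
    -- `noiseTerm` comes from.
    have h1 : W * stack O = W * stack Θ + W * (stack O - stack Θ) := by
      rw [Matrix.mul_sub]; abel
    have h2 := frobNorm_add_le (rowBlock (W * stack Θ) i)
      (rowBlock (W * (stack O - stack Θ)) i)
    have h3 := (frobNorm_rowBlock_le (W * (stack O - stack Θ)) i).trans
      (frobNorm_mul_le_opNorm W _)
    have h4 : opNorm W * ε ≤ 4 * opNorm W ^ 2 * √((r : ℝ) / m) :=
      (mul_le_mul_of_nonneg_left hε1 hω0).trans_eq (by ring)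
    have h5 := le_iSup_frobNorm_rowBlock (W * stack Θ) i
    rw [noiseTerm] at hA
    rw [h1, rowBlock_add]
    linarith
  have hδ : ∀ i, frobNorm (O i - Θ i) ≤ 0.111 := by
    intro i
    have h1 := hO.mul_frobNorm_block_sub_le hW hΘ hP i
    rw [← hε] at h1
    have h2 : 0.96 * m * frobNorm (O i - Θ i)
        ≤ (m - ε ^ 2 / 2 - opNorm W) * frobNorm (O i - Θ i) :=
      mul_le_mul_of_nonneg_right (by linarith) (frobNorm_nonneg _)
    refine le_of_mul_le_mul_left ?_ hmR
    linarith [hN i]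
  -- Each multiplier lies within `(0.0072 + 0.111 · 1.0072 + 0.0529) m < 0.2 m` of `m I`, whence `t
  -- = 0.8 m`; and `‖E‖² + ‖W‖ ≤ 0.0444 m` is below `t - κ = 0.1 m`.
  refine isSDPSolution_iff_of_certificate hm (isSymm_dataMatrix hW) hO.1 _
    (fun i => (hO.stationary hW i).2) (t := 0.8 * m) (κ := 0.7 * m) (by positivity)
    (fun i => posSemidef_sub_smul_one (hO.stationary hW i).1 (c := m) ?_) (fun Z hZ => ?_) U
  · have h1 := frobNorm_multiplier_sub_le (W := W) hΘ hO.1 hP i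
    rw [← hε] at h1
    have h2 : frobNorm (O i - Θ i) * (m + ε ^ 2 / 2) ≤ 0.111 * (1.0072 * m) :=
      mul_le_mul (hδ i) (by linarith) (by positivity) (by norm_num)
    linarith [hN i]
  · refine (trace_dataMatrix_conj_le Z hZ).trans
      (mul_le_mul_of_nonneg_right ?_ (sq_nonneg _))
    linarith

/-- Tightness of the relaxation, given that it has a single solution of the form `V Vᵀ`. -/
lemma equivalences_of_unique (hm : 0 < m) {S : Matrix (Idx d) (Idx d) ℝ} (hS : S.IsSymm)
    (hO : IsTraceSumSolution S O)
    (huniq : ∀ U, IsSDPSolution r S U ↔ U = stack O * (stack O)ᵀ) :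
    (∀ U, IsSDPSolution r S U ↔ IsRankSolution r S U) ∧
      ∀ U, IsSDPSolution r S U ↔ ∃ O' : (i : Fin m) → Matrix (Fin (d i)) (Fin r) ℝ,
        IsTraceSumSolution S O' ∧ U = stack O' * (stack O')ᵀ := by
  have hsol := (huniq _).2 rfl
  refine ⟨fun U => ⟨fun hU => ?_, fun hU => ⟨hU.1.1, fun U' hU' => ?_⟩⟩,
    fun U => ⟨fun hU => ⟨O, hO, (huniq U).1 hU⟩, ?_⟩⟩
  · refine ⟨⟨hU.1, ?_⟩, fun U' hU' _ => ?_⟩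
    · rw [(huniq U).1 hU]
      exact rank_stack_mul_transpose hm hO.1
    · simpa only [hS.eq] using hU.2 U' hU'
  · have h1 := hU.2 _ hsol.1 (rank_stack_mul_transpose hm hO.1)
    have h2 := hsol.2 U' hU'
    rw [hS.eq] at h2 ⊢
    exact h2.trans h1
  · rintro ⟨O', hO', rfl⟩
    refine ⟨stack_mul_transpose_mem_sdpFeasible hO'.1, fun U' hU' => ?_⟩
    have h1 := hsol.2 U' hU'
    have h2 := hO'.2 O hO.1
    rw [hS.eq] at h1 ⊢
    rw [traceSum_eq_trace_mul, traceSum_eq_trace_mul] at h2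
    exact h1.trans h2

end Tightness

end OTSM

theorem mainTheorem5 (m r : ℕ) (hm : 8 ≤ m) (hr : 1 ≤ r) (d : Fin m → ℕ)
    (Θ : (i : Fin m) → Matrix (Fin (d i)) (Fin r) ℝ)
    (hΘ : ∀ i, Θ i ∈ OTSM.stiefel (d i) r)
    (W : Matrix (OTSM.Idx d) (OTSM.Idx d) ℝ)
    (σ : ℝ) (hσ : 0 < σ)
    (hW : OTSM.IsDiscordant Θ (σ⁻¹ • W))
    (hσ_le : σ ≤ (m : ℝ) ^ (1 / 4 : ℝ) / (60 * √(((∑ i, d i : ℕ) : ℝ) / m * r))) :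
    OTSM.NoiseCondition Θ W ∧
    (∀ U : Matrix (OTSM.Idx d) (OTSM.Idx d) ℝ,
      OTSM.IsSDPSolution r (OTSM.dataMatrix Θ W) U ↔
        OTSM.IsRankSolution r (OTSM.dataMatrix Θ W) U) ∧
    (∀ U : Matrix (OTSM.Idx d) (OTSM.Idx d) ℝ,
      OTSM.IsSDPSolution r (OTSM.dataMatrix Θ W) U ↔
        ∃ O : (i : Fin m) → Matrix (Fin (d i)) (Fin r) ℝ,
          OTSM.IsTraceSumSolution (OTSM.dataMatrix Θ W) O ∧
            U = OTSM.stack O * (OTSM.stack O)ᵀ) := by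
  have hm8 : (8 : ℝ) ≤ m := by exact_mod_cast hm
  have hm0 : 0 < m := by omega
  have hWs : W.IsSymm := by
    have h := hW.symm.smul σ
    rwa [smul_smul, mul_inv_cancel₀ hσ.ne', one_smul] at h
  set u : ℝ := (m : ℝ) ^ (1 / 4 : ℝ) with hu
  have hu0 : 0 < u := Real.rpow_pos_of_pos (by linarith) _
  have hum : u ^ 4 = m := by
    rw [hu, ← Real.rpow_natCast, ← Real.rpow_mul (by linarith)]
    norm_num
  -- `1.68⁴ < 8 ≤ m`.
  have hu1 : 1.68 ≤ u := by
    by_contra! h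
    have := pow_lt_pow_left₀ h hu0.le (n := 4) (by norm_num)
    norm_num at this
    linarith
  obtain ⟨hω, hB⟩ := OTSM.noise_bounds hu0 hum hr hσ hW hσ_le
  have hA := OTSM.noiseTerm_le hu0 hum hr hω hB
  refine ⟨OTSM.noiseCondition_of_bounds hu1 hum hm hr hω hA, ?_⟩
  obtain ⟨O, hO, hP⟩ := OTSM.exists_isTraceSumSolution hΘ (OTSM.dataMatrix Θ W)
  refine OTSM.equivalences_of_unique hm0 (OTSM.isSymm_dataMatrix hWs) hO fun U =>
    OTSM.isSDPSolution_iff_eq_stack hm0 hr hWs hΘ (hω.trans ?_) (hA.trans_eq (by rw [hum])) hO hP U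
  -- `u³ / 20 ≤ u⁴ / (20 · 1.68) < 0.03 m`.
  rw [← hum, pow_succ' u 3]
  have h3 : 0 < u ^ 3 := by positivity
  linarith [mul_le_mul_of_nonneg_right hu1 h3.le]
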